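/- Let $T,T'$ be contractions (bounded linear operators of norm at most $1$) on a complex Hilbert space $\mathcal H$. Suppose that $T$ is Harnack dominated by $T'$, that is, there is a constant $c\ge 1$ such that for every polynomial $p$ with complex coefficients satisfying $\operatorname{Re} p(z)\ge 0$ for all $|z|\le 1$, one has $\operatorname{Re} p(T)\le c\,\operatorname{Re} p(T')$, where $\operatorname{Re} A=\tfrac12(A+A^*)$ and $\le$ is the usual order of self-adjoint operators ($A\le B$ means $\langle (B-A)h,h\rangle\ge 0$ for all $h\in\mathcal H$). Let $\mathbb D$ be the open unit disc and $\mathbb T$ the unit circle in $\mathbb C$, and let $\sigma(\cdot)$ and $\sigma_p(\cdot)$ denote the spectrum and the point spectrum (the set of eigenvalues). Then $$\sigma(T)\cap\mathbb T=\sigma(T')\cap\mathbb T\quad\text{and}\quad \sigma_p(T)\cap\mathbb T=\sigma_p(T')\cap\mathbb T.$$ In particular, $\sigma(T)\subset\mathbb D$ if and only if $\sigma(T')\subset\mathbb D$. -/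

import Mathlib

open scoped ComplexStarModule

section HarnackDefs

variable {H : Type*} [NormedAddCommGroup H] [InnerProductSpace ℂ H] [CompleteSpace H]

/-- `T` is Harnack dominated by `T'` with constant `c`: for every polynomial `p` with complex
coefficients whose real part is nonnegative on the closed unit disc, `Re p(T) ≤ c Re p(T')`.
Here `ℜ A = (A + A*) / 2`, and `≤` is the Loewner order of bounded operators. -/
def HarnackDominatedWith (c : ℝ) (T T' : H →L[ℂ] H) : Prop :=
  ∀ p : Polynomial ℂ, (∀ z : ℂ, ‖z‖ ≤ 1 → 0 ≤ (p.eval z).re) →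
    (ℜ (Polynomial.aeval T p) : H →L[ℂ] H) ≤ c • (ℜ (Polynomial.aeval T' p) : H →L[ℂ] H)

/-- `T` is Harnack dominated by `T'`: this holds with some constant `c ≥ 1`. -/
def HarnackDominated (T T' : H →L[ℂ] H) : Prop :=
  ∃ c : ℝ, 1 ≤ c ∧ HarnackDominatedWith c T T'

/-- The point spectrum of a bounded operator, that is, the set of its eigenvalues. -/
def pointSpectrum (T : H →L[ℂ] H) : Set ℂ :=
  {μ : ℂ | Module.End.HasEigenvalue (T : H →ₗ[ℂ] H) μ}

end HarnackDefs

/-! Domination survives a common rotation of `T` and `T'`, so only the point `1` matters. For a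
contraction `A`, `‖x - A x‖²` is at most `2 Re⟪x - A x, x⟫`; hence `1` is in the spectrum exactly
when it is an approximate eigenvalue, and `1 - A` has dense range when it is injective. From `T'` to
`T`, the polynomial `1 - z` suffices: an (almost) fixed vector of `T'` is (almost) fixed by `T`.
From `T` to `T'`, use the Poisson kernels `(1 + r z) / (1 - r z)` with `s = 1 - r` small
(`re_inner_resolvent_le`). On an (almost) fixed vector of `T` the form grows like `2 / s`. For `T'`
it stays bounded if `1 - T'` is bounded below, and is `o(1 / s)` if `1 - T'` merely has dense range.
-/

section HarnackSpectrum

open scoped InnerProductSpace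
open Filter Topology Polynomial

variable {H : Type*} [NormedAddCommGroup H] [InnerProductSpace ℂ H]

/-! ### Fixed vectors of contractions -/

/-- If `re ⟪A x, x⟫` is close to `‖x‖²`, then `x` is almost fixed by the contraction `A`. -/
lemma norm_sub_apply_sq_le {A : H →L[ℂ] H} (hA : ‖A‖ ≤ 1) (x : H) :
    ‖x - A x‖ ^ 2 ≤ 2 * (⟪x - A x, x⟫_ℂ).re := by
  have h1 : ‖A x‖ ≤ ‖x‖ := by simpa using A.le_of_opNorm_le hA x
  have h2 := norm_sub_sq (𝕜 := ℂ) x (A x)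
  have h3 : (⟪x - A x, x⟫_ℂ).re = ‖x‖ ^ 2 - (⟪x, A x⟫_ℂ).re := by
    rw [inner_sub_left, Complex.sub_re, ← inner_conj_symm (A x) x, Complex.conj_re]
    congr 1
    exact inner_self_eq_norm_sq (𝕜 := ℂ) x
  have h4 : RCLike.re ⟪x, A x⟫_ℂ = (⟪x, A x⟫_ℂ).re := rfl
  rw [h3]
  nlinarith [norm_nonneg (A x)]

variable [CompleteSpace H]

/-- A vector orthogonal to the range gives `⟪x - A x, x⟫ = 0`, which for a contraction forces `A x =
x`. -/
lemma range_one_sub_topologicalClosure_eq_top {A : H →L[ℂ] H} (hA : ‖A‖ ≤ 1)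
    (hfix : ∀ x, A x = x → x = 0) : (1 - A).range.topologicalClosure = ⊤ := by
  rw [Submodule.topologicalClosure_eq_top_iff, Submodule.eq_bot_iff]
  intro x hx
  have h : ⟪x - A x, x⟫_ℂ = 0 := hx (x - A x) ⟨x, rfl⟩
  have h2 := norm_sub_apply_sq_le hA x
  rw [h, Complex.zero_re, mul_zero] at h2
  have h3 : x - A x = 0 := by
    rw [← norm_eq_zero]
    exact pow_eq_zero_iff two_ne_zero |>.1 (le_antisymm h2 (sq_nonneg _))
  exact hfix x (sub_eq_zero.1 h3).symm

lemma isUnit_one_sub_of_forall_le {A : H →L[ℂ] H} (hA : ‖A‖ ≤ 1) {δ : ℝ} (hδ : 0 < δ)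
    (h : ∀ x, δ * ‖x‖ ≤ ‖x - A x‖) : IsUnit (1 - A) := by
  rw [ContinuousLinearMap.isUnit_iff_bijective,
    ContinuousLinearMap.bijective_iff_dense_range_and_antilipschitz]
  refine ⟨range_one_sub_topologicalClosure_eq_top hA fun x hx ↦ ?_, ⟨δ⁻¹, hδ.le |> inv_nonneg.2⟩,
    ContinuousLinearMap.antilipschitz_of_bound _ fun x ↦ ?_⟩
  · have := h x
    rw [hx, sub_self, norm_zero] at this
    exact norm_eq_zero.1 (le_antisymm (by nlinarith) (norm_nonneg x))
  · change ‖x‖ ≤ δ⁻¹ * ‖x - A x‖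
    rw [inv_mul_eq_div, le_div_iff₀ hδ, mul_comm]
    exact h x

omit [CompleteSpace H] in
lemma exists_forall_le_of_isUnit_one_sub {A : H →L[ℂ] H} (h : IsUnit (1 - A)) :
    ∃ δ > 0, ∀ x, δ * ‖x‖ ≤ ‖x - A x‖ := by
  obtain ⟨u, hu⟩ := h
  refine ⟨(‖(↑u⁻¹ : H →L[ℂ] H)‖ + 1)⁻¹, by positivity, fun x ↦ ?_⟩
  rw [inv_mul_le_iff₀ (by positivity)]
  have h1 : (↑u⁻¹ : H →L[ℂ] H) (x - A x) = x := by
    have := congrArg (fun B : H →L[ℂ] H ↦ B x) u.inv_mul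
    rw [hu] at this
    exact this
  calc ‖x‖ = ‖(↑u⁻¹ : H →L[ℂ] H) (x - A x)‖ := by rw [h1]
    _ ≤ ‖(↑u⁻¹ : H →L[ℂ] H)‖ * ‖x - A x‖ := ContinuousLinearMap.le_opNorm _ _
    _ ≤ _ := by gcongr; linarith

/-- `1` lies in the spectrum of a contraction iff it is an approximate eigenvalue. -/
lemma one_mem_spectrum_iff {A : H →L[ℂ] H} (hA : ‖A‖ ≤ 1) :
    (1 : ℂ) ∈ spectrum ℂ A ↔ ∀ δ > 0, ∃ x, ‖x - A x‖ < δ * ‖x‖ := by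
  rw [spectrum.mem_iff, map_one, not_iff_comm]
  push Not
  exact ⟨fun ⟨δ, hδ, h⟩ ↦ isUnit_one_sub_of_forall_le hA hδ h, exists_forall_le_of_isUnit_one_sub⟩

/-! ### Resolvent equation -/

lemma exists_sub_smul_apply_eq {A : H →L[ℂ] H} (hA : ‖A‖ ≤ 1) {r : ℝ} (hr0 : 0 ≤ r) (hr1 : r < 1)
    (x : H) : ∃ y, y - (r : ℂ) • A y = x := by
  have hn : ‖(r : ℂ) • A‖ < 1 := by
    rw [norm_smul, Complex.norm_real, Real.norm_of_nonneg hr0]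
    nlinarith [norm_nonneg A]
  refine ⟨(↑(Units.oneSub _ hn)⁻¹ : H →L[ℂ] H) x, ?_⟩
  exact congrArg (fun B : H →L[ℂ] H ↦ B x) (Units.oneSub _ hn).mul_inv

omit [CompleteSpace H] in
lemma norm_le_of_sub_smul_apply {A : H →L[ℂ] H} (hA : ‖A‖ ≤ 1) {r : ℝ} (hr0 : 0 ≤ r) (y : H) :
    (1 - r) * ‖y‖ ≤ ‖y - (r : ℂ) • A y‖ := by
  have h1 : ‖A y‖ ≤ ‖y‖ := by simpa using A.le_of_opNorm_le hA y
  have h2 := norm_sub_norm_le y ((r : ℂ) • A y)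
  rw [norm_smul, Complex.norm_real, Real.norm_of_nonneg hr0] at h2
  nlinarith

/-! ### Harnack domination -/

lemma HarnackDominatedWith.re_inner_le {c : ℝ} {T T' : H →L[ℂ] H}
    (h : HarnackDominatedWith c T T') {p : ℂ[X]} (hp : ∀ z : ℂ, ‖z‖ ≤ 1 → 0 ≤ (p.eval z).re)
    (x : H) : (⟪aeval T p x, x⟫_ℂ).re ≤ c * (⟪aeval T' p x, x⟫_ℂ).re := by
  have key : ∀ B : H →L[ℂ] H, (⟪(ℜ B : H →L[ℂ] H) x, x⟫_ℂ).re = (⟪B x, x⟫_ℂ).re := by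
    intro B
    rw [realPart_apply_coe, ContinuousLinearMap.star_eq_adjoint]
    simp only [smul_apply, add_apply]
    rw [inner_smul_left_eq_smul, inner_add_left, ContinuousLinearMap.adjoint_inner_left,
      ← inner_conj_symm x (B x)]
    simp only [Complex.real_smul, Complex.re_ofReal_mul, Complex.add_re, Complex.conj_re]
    ring
  have h1 := ((ContinuousLinearMap.le_def _ _).1 (h p hp)).re_inner_nonneg_left x
  rw [sub_apply, inner_sub_left, map_sub, smul_apply,
    inner_smul_left_eq_smul] at h1
  have h2 := key (aeval T p)
  have h3 := key (aeval T' p)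
  simp only [RCLike.re_to_complex, Complex.real_smul, Complex.re_ofReal_mul] at h1
  rw [h2, h3] at h1
  linarith

/-- Harnack domination is invariant under simultaneous rotation. -/
lemma HarnackDominatedWith.smul {c : ℝ} {T T' : H →L[ℂ] H}
    (h : HarnackDominatedWith c T T') {w : ℂ} (hw : ‖w‖ = 1) :
    HarnackDominatedWith c (w • T) (w • T') := by
  intro p hp
  have key : ∀ B : H →L[ℂ] H, aeval (w • B) p = aeval B (p.comp (C w * X)) := by
    intro B
    rw [aeval_comp, map_mul, aeval_C, aeval_X, Algebra.smul_def]
  rw [key, key]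
  refine h _ fun z hz ↦ ?_
  rw [eval_comp]
  refine hp _ ?_
  simpa [hw] using hz

lemma HarnackDominatedWith.re_inner_sub_apply_le {c : ℝ} {T T' : H →L[ℂ] H}
    (h : HarnackDominatedWith c T T') (x : H) :
    (⟪x - T x, x⟫_ℂ).re ≤ c * (⟪x - T' x, x⟫_ℂ).re := by
  have := h.re_inner_le (p := 1 - X) (fun z hz ↦ ?_) x
  · simpa using this
  · have := (Complex.re_le_norm z).trans hz
    simpa using this

/-- The full series sums to `(1 + w) / (1 - w)`, of nonnegative real part. The added constant
dominates the discarded tail, so the truncations are admissible test polynomials. -/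
lemma re_geom_sum_nonneg {r : ℝ} (hr1 : r < 1) {w : ℂ} (hw : ‖w‖ ≤ r) (N : ℕ) :
    0 ≤ (2 * ∑ k ∈ Finset.range N, w ^ k - 1 + ((2 * r ^ N / (1 - r) : ℝ) : ℂ)).re := by
  have hw1 : ‖w‖ < 1 := hw.trans_lt hr1
  have hne : 1 - w ≠ 0 := by
    intro h0
    rw [← sub_eq_zero.1 h0, norm_one] at hw1
    exact lt_irrefl _ hw1
  have e1 : 2 * ∑ k ∈ Finset.range N, w ^ k - 1 = (1 + w) / (1 - w) - 2 * w ^ N / (1 - w) := by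
    have := geom_sum_mul_neg w N
    rw [← sub_div, eq_div_iff hne]
    linear_combination 2 * this
  have h1 : 0 ≤ ((1 + w) / (1 - w)).re := by
    rw [Complex.div_re, ← add_div]
    refine div_nonneg ?_ (Complex.normSq_nonneg _)
    have := Complex.sq_norm w
    rw [Complex.normSq_apply] at this
    simp only [Complex.add_re, Complex.sub_re, Complex.one_re, Complex.add_im, Complex.sub_im,
      Complex.one_im]
    nlinarith [norm_nonneg w]
  have h2 : ‖2 * w ^ N / (1 - w)‖ ≤ 2 * r ^ N / (1 - r) := by
    rw [norm_div, norm_mul, norm_pow, Complex.norm_ofNat]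
    have h3 := norm_sub_norm_le 1 w
    rw [norm_one] at h3
    have h4 : 0 < 1 - r := by linarith
    have h5 : 0 ≤ r := (norm_nonneg w).trans hw
    gcongr
    linarith
  have h3 := (Complex.re_le_norm _).trans h2
  rw [e1, Complex.add_re, Complex.sub_re, Complex.ofReal_re]
  linarith

omit [CompleteSpace H] in
lemma tendsto_geom_sum_apply {A : H →L[ℂ] H} (hA : ‖A‖ < 1) {x y : H} (hy : y - A y = x) :
    Tendsto (fun N : ℕ ↦ (∑ k ∈ Finset.range N, A ^ k) x) atTop (𝓝 y) := by
  have e : ∀ N : ℕ, (∑ k ∈ Finset.range N, A ^ k) x = y - (A ^ N) y := by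
    intro N
    rw [← hy]
    exact congrArg (fun B : H →L[ℂ] H ↦ B y) (geom_sum_mul_neg A N)
  have h1 : Tendsto (fun N : ℕ ↦ (A ^ N) y) atTop (𝓝 0) := by
    have h2 := tendsto_pow_atTop_nhds_zero_of_norm_lt_one hA
    exact ((ContinuousLinearMap.apply ℂ H y).continuous.tendsto' 0 0 (map_zero _)).comp h2
  simp_rw [e]
  simpa using tendsto_const_nhds.sub h1

/-- Harnack domination for the Poisson kernels `(1 + r z) / (1 - r z) = 2 / (1 - r z) - 1`. -/
lemma HarnackDominatedWith.re_inner_resolvent_le {c : ℝ} {T T' : H →L[ℂ] H}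
    (h : HarnackDominatedWith c T T') (hT : ‖T‖ ≤ 1) (hT' : ‖T'‖ ≤ 1) {r : ℝ} (hr0 : 0 ≤ r)
    (hr1 : r < 1) {x y y' : H} (hy : y - (r : ℂ) • T y = x) (hy' : y' - (r : ℂ) • T' y' = x) :
    (⟪(2 : ℂ) • y - x, x⟫_ℂ).re ≤ c * (⟪(2 : ℂ) • y' - x, x⟫_ℂ).re := by
  let ε : ℕ → ℝ := fun N ↦ 2 * r ^ N / (1 - r)
  let p : ℕ → ℂ[X] := fun N ↦ C 2 * ∑ k ∈ Finset.range N, (C (r : ℂ) * X) ^ k - 1 + C ((ε N : ℝ) : ℂ)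
  have hp : ∀ N, ∀ z : ℂ, ‖z‖ ≤ 1 → 0 ≤ ((p N).eval z).re := by
    intro N z hz
    have hw : ‖(r : ℂ) * z‖ ≤ r := by
      rw [norm_mul, Complex.norm_real, Real.norm_of_nonneg hr0]
      exact mul_le_of_le_one_right hr0 hz
    have := re_geom_sum_nonneg hr1 hw N
    simpa only [p, eval_add, eval_sub, eval_mul, eval_C, eval_one, eval_finsetSum, eval_pow, eval_X]
      using this
  have hε : Tendsto (fun N ↦ ((ε N : ℝ) : ℂ)) atTop (𝓝 0) := by
    have := ((tendsto_pow_atTop_nhds_zero_of_lt_one hr0 hr1).const_mul 2).div_const (1 - r)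
    rw [mul_zero, zero_div] at this
    exact (Complex.continuous_ofReal.tendsto' 0 0 Complex.ofReal_zero).comp this
  have lim : ∀ B : H →L[ℂ] H, ‖B‖ ≤ 1 → ∀ v : H, v - (r : ℂ) • B v = x →
      Tendsto (fun N ↦ (⟪aeval B (p N) x, x⟫_ℂ).re) atTop (𝓝 (⟪(2 : ℂ) • v - x, x⟫_ℂ).re) := by
    intro B hB v hv
    have hn : ‖(r : ℂ) • B‖ < 1 := by
      rw [norm_smul, Complex.norm_real, Real.norm_of_nonneg hr0]
      nlinarith [norm_nonneg B]
    have e : ∀ N, aeval B (p N) x =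
        (2 : ℂ) • (∑ k ∈ Finset.range N, ((r : ℂ) • B) ^ k) x - x + (ε N : ℂ) • x := by
      intro N
      have : aeval B (p N) =
          (2 : ℂ) • (∑ k ∈ Finset.range N, ((r : ℂ) • B) ^ k) - 1 + (ε N : ℂ) • 1 := by
        simp only [p, map_add, map_sub, map_mul, map_sum, map_pow, aeval_C, aeval_X, map_one,
          Algebra.smul_def, mul_one]
      rw [this]
      rfl
    simp_rw [e]
    have h1 : Tendsto (fun N ↦ (2 : ℂ) • (∑ k ∈ Finset.range N, ((r : ℂ) • B) ^ k) x - x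
        + (ε N : ℂ) • x) atTop (𝓝 ((2 : ℂ) • v - x + (0 : ℂ) • x)) :=
      (((tendsto_geom_sum_apply hn hv).const_smul (2 : ℂ)).sub_const x).add (hε.smul_const x)
    rw [zero_smul, add_zero] at h1
    exact (Complex.continuous_re.tendsto _).comp (h1.inner tendsto_const_nhds)
  exact le_of_tendsto_of_tendsto' (lim T hT y hy) ((lim T' hT' y' hy').const_mul c)
    fun N ↦ h.re_inner_le (hp N) x

/-! ### Transfer of (approximate) fixed vectors -/

lemma HarnackDominatedWith.norm_sub_apply_sq_le {c : ℝ} (hc : 0 ≤ c) {T T' : H →L[ℂ] H}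
    (h : HarnackDominatedWith c T T') (hT : ‖T‖ ≤ 1) (x : H) :
    ‖x - T x‖ ^ 2 ≤ 2 * c * (‖x - T' x‖ * ‖x‖) := by
  have h1 := h.re_inner_sub_apply_le x
  have h2 := _root_.norm_sub_apply_sq_le hT x
  have h3 := (Complex.re_le_norm _).trans (norm_inner_le_norm (𝕜 := ℂ) (x - T' x) x)
  nlinarith

lemma HarnackDominatedWith.apply_eq_self {c : ℝ} (hc : 0 ≤ c) {T T' : H →L[ℂ] H}
    (h : HarnackDominatedWith c T T') (hT : ‖T‖ ≤ 1) {x : H} (hx : T' x = x) : T x = x := by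
  have h1 := h.norm_sub_apply_sq_le hc hT x
  rw [hx, sub_self, norm_zero, zero_mul, mul_zero] at h1
  have : ‖x - T x‖ = 0 := pow_eq_zero_iff two_ne_zero |>.1 (le_antisymm h1 (sq_nonneg _))
  exact (sub_eq_zero.1 (norm_eq_zero.1 this)).symm

lemma HarnackDominatedWith.one_mem_spectrum_left {c : ℝ} (hc : 0 < c) {T T' : H →L[ℂ] H}
    (h : HarnackDominatedWith c T T') (hT : ‖T‖ ≤ 1) (hT' : ‖T'‖ ≤ 1)
    (h1 : (1 : ℂ) ∈ spectrum ℂ T') : (1 : ℂ) ∈ spectrum ℂ T := by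
  rw [one_mem_spectrum_iff hT'] at h1
  rw [one_mem_spectrum_iff hT]
  intro δ hδ
  -- Chosen to cancel the factor `2 * c` and leave `δ ^ 2` under the square.
  obtain ⟨x, hx⟩ := h1 (δ ^ 2 / (2 * c)) (by positivity)
  refine ⟨x, ?_⟩
  have hx0 : 0 < ‖x‖ := by
    by_contra h0
    have : ‖x‖ = 0 := le_antisymm (not_lt.1 h0) (norm_nonneg x)
    rw [this, mul_zero] at hx
    exact absurd hx (norm_nonneg _).not_gt
  have h2 := h.norm_sub_apply_sq_le hc.le hT x
  rw [div_mul_eq_mul_div, lt_div_iff₀ (by positivity)] at hx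
  refine lt_of_pow_lt_pow_left₀ 2 (by positivity) ?_
  nlinarith

lemma HarnackDominatedWith.one_mem_spectrum_right {c : ℝ} (hc : 0 < c) {T T' : H →L[ℂ] H}
    (h : HarnackDominatedWith c T T') (hT : ‖T‖ ≤ 1) (hT' : ‖T'‖ ≤ 1)
    (h1 : (1 : ℂ) ∈ spectrum ℂ T) : (1 : ℂ) ∈ spectrum ℂ T' := by
  rw [one_mem_spectrum_iff hT] at h1
  rw [one_mem_spectrum_iff hT']
  by_contra! hcon
  obtain ⟨δ, hδ, hb⟩ := hcon
  -- the parameter `s = 1 - r`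
  obtain ⟨s, hs0, hs1, hsδ, hsc⟩ : ∃ s : ℝ, 0 < s ∧ s ≤ 1 ∧ s ≤ δ / 2 ∧
      s * (4 * c / δ + 3) < 2 := by
    refine ⟨min (min 1 (δ / 2)) (4 * c / δ + 3)⁻¹, by positivity,
      (min_le_left _ _).trans (min_le_left _ _), (min_le_left _ _).trans (min_le_right _ _), ?_⟩
    have hpos : 0 < 4 * c / δ + 3 := by positivity
    calc _ ≤ (4 * c / δ + 3)⁻¹ * (4 * c / δ + 3) := by gcongr; exact min_le_right _ _
      _ = 1 := inv_mul_cancel₀ hpos.ne'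
      _ < 2 := one_lt_two
  obtain ⟨x, hx⟩ := h1 (s ^ 2 / 2) (by positivity)
  have hx0 : 0 < ‖x‖ := by
    by_contra h0
    have : ‖x‖ = 0 := le_antisymm (not_lt.1 h0) (norm_nonneg x)
    rw [this, mul_zero] at hx
    exact absurd hx (norm_nonneg _).not_gt
  obtain ⟨y, hy⟩ := exists_sub_smul_apply_eq hT (r := 1 - s) (by linarith) (by linarith) x
  obtain ⟨y', hy'⟩ := exists_sub_smul_apply_eq hT' (r := 1 - s) (by linarith) (by linarith) x
  have main := h.re_inner_resolvent_le hT hT' (by linarith) (by linarith) hy hy'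
  have ub : (⟪(2 : ℂ) • y' - x, x⟫_ℂ).re ≤ 4 / δ * ‖x‖ ^ 2 := by
    have e : x = (y' - T' y') + (s : ℂ) • T' y' := by
      rw [← hy']; push_cast; module
    have h2 : ‖T' y'‖ ≤ ‖y'‖ := by simpa using T'.le_of_opNorm_le hT' y'
    have h3 : δ / 2 * ‖y'‖ ≤ ‖x‖ := by
      have h4 := norm_sub_le x ((s : ℂ) • T' y')
      rw [show x - (s : ℂ) • T' y' = y' - T' y' from sub_eq_iff_eq_add.2 e, norm_smul,
        Complex.norm_real, Real.norm_of_nonneg hs0.le] at h4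
      have h5 := hb y'
      nlinarith [norm_nonneg y', norm_nonneg (T' y')]
    have h4 : ‖y'‖ ≤ 2 / δ * ‖x‖ := by
      rw [div_mul_eq_mul_div, le_div_iff₀ hδ]; linarith
    have h5 : (⟪y', x⟫_ℂ).re ≤ ‖y'‖ * ‖x‖ :=
      (Complex.re_le_norm _).trans (norm_inner_le_norm (𝕜 := ℂ) _ _)
    have h6 : (⟪x, x⟫_ℂ).re = ‖x‖ ^ 2 := inner_self_eq_norm_sq (𝕜 := ℂ) x
    rw [inner_sub_left, inner_smul_left, Complex.sub_re, h6, Complex.conj_ofNat, Complex.mul_re,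
      Complex.re_ofNat, Complex.im_ofNat, zero_mul, sub_zero]
    have h7 : ‖y'‖ * ‖x‖ ≤ 2 / δ * ‖x‖ * ‖x‖ := by gcongr
    have h8 : 4 / δ * ‖x‖ ^ 2 = 2 * (2 / δ * ‖x‖ * ‖x‖) := by ring
    nlinarith [sq_nonneg ‖x‖]
  have lb : (2 / s - 2) * ‖x‖ ^ 2 ≤ (⟪(2 : ℂ) • y - x, x⟫_ℂ).re := by
    have hsC : (s : ℂ) ≠ 0 := by exact_mod_cast hs0.ne'
    -- If `x` were fixed by `T`, then `s • y = x`. The error `d` solves the resolvent equation with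
    -- right side `(1 - s) • (T x - x)`; inverting costs `1 / s`, hence the accuracy `s ^ 2 / 2`
    -- asked of `x`.
    obtain ⟨d, hd⟩ : ∃ d, d = (s : ℂ) • y - x := ⟨_, rfl⟩
    have hdn : ‖d‖ ≤ s / 2 * ‖x‖ := by
      have e : d - ((1 - s : ℝ) : ℂ) • T d = ((1 - s : ℝ) : ℂ) • (T x - x) := by
        have : (s : ℂ) • (y - ((1 - s : ℝ) : ℂ) • T y) = (s : ℂ) • x := by rw [hy]
        rw [hd, map_sub, map_smul, ← sub_eq_zero]
        rw [← sub_eq_zero] at this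
        rw [← this]
        push_cast
        module
      have h2 := norm_le_of_sub_smul_apply hT (r := 1 - s) (by linarith) d
      rw [e, norm_smul, Complex.norm_real, Real.norm_of_nonneg (by linarith), norm_sub_rev (T x)] at h2
      have h3 : s * ‖d‖ ≤ s * (s / 2 * ‖x‖) := by nlinarith [norm_nonneg (x - T x)]
      exact le_of_mul_le_mul_left h3 hs0
    have e2 : (2 : ℂ) • y - x = ((2 / s - 1 : ℝ) : ℂ) • x + ((2 / s : ℝ) : ℂ) • d := by
      rw [hd]
      push_cast
      rw [smul_sub, smul_smul, div_mul_cancel₀ _ hsC]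
      module
    have h6 : (⟪x, x⟫_ℂ).re = ‖x‖ ^ 2 := inner_self_eq_norm_sq (𝕜 := ℂ) x
    have h7 : -(‖d‖ * ‖x‖) ≤ (⟪d, x⟫_ℂ).re :=
      (neg_le_neg (norm_inner_le_norm (𝕜 := ℂ) _ _)).trans
        (neg_le_of_abs_le (Complex.abs_re_le_norm _))
    rw [e2, inner_add_left, inner_smul_left, inner_smul_left, Complex.conj_ofReal,
      Complex.conj_ofReal, Complex.add_re, Complex.re_ofReal_mul, Complex.re_ofReal_mul, h6]
    have h8 : ‖d‖ * ‖x‖ ≤ s / 2 * ‖x‖ * ‖x‖ := by gcongr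
    have h9 : 2 / s * -(s / 2 * ‖x‖ * ‖x‖) ≤ 2 / s * (⟪d, x⟫_ℂ).re := by
      gcongr; linarith
    have h10 : 2 / s * -(s / 2 * ‖x‖ * ‖x‖) = -‖x‖ ^ 2 := by field_simp
    linarith
  have h2 : (2 / s - 2) * ‖x‖ ^ 2 ≤ (4 * c / δ) * ‖x‖ ^ 2 := by
    calc _ ≤ c * (4 / δ * ‖x‖ ^ 2) := lb.trans (main.trans (by gcongr))
      _ = _ := by ring
  have h3 : 2 / s - 2 ≤ 4 * c / δ := le_of_mul_le_mul_right h2 (by positivity)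
  have h4 : 2 / s ≤ 4 * c / δ + 2 := by linarith
  rw [div_le_iff₀ hs0] at h4
  nlinarith

/-- If `T` has a nonzero fixed vector, then so has any `T'` that Harnack dominates `T`. -/
lemma HarnackDominatedWith.exists_apply_eq_self {c : ℝ} (hc : 0 < c) {T T' : H →L[ℂ] H}
    (h : HarnackDominatedWith c T T') (hT : ‖T‖ ≤ 1) (hT' : ‖T'‖ ≤ 1) {x : H} (hx0 : x ≠ 0)
    (hx : T x = x) : ∃ v, v ≠ 0 ∧ T' v = v := by
  by_contra! hcon
  have hd : Dense ((1 - T').range : Set H) := by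
    rw [Submodule.dense_iff_topologicalClosure_eq_top]
    exact range_one_sub_topologicalClosure_eq_top hT' fun v hv ↦ by
      by_contra h0
      exact hcon v h0 hv
  have hxn : 0 < ‖x‖ := norm_pos_iff.2 hx0
  obtain ⟨_, ⟨u, rfl⟩, hu⟩ := hd.exists_dist_lt x (show 0 < ‖x‖ / (4 * c) by positivity)
  change dist x (u - T' u) < _ at hu
  rw [dist_eq_norm] at hu
  -- The `+ 1` gives `4 * c * s * ‖u‖ < ‖x‖ / 2` strictly; the error `‖x‖ / (4 * c)` supplies the
  -- other half, against the lower bound `(2 - s) * ‖x‖ ≥ ‖x‖`.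
  obtain ⟨s, hs0, hs1, hsu⟩ : ∃ s : ℝ, 0 < s ∧ s ≤ 1 ∧ s * (8 * c * (‖u‖ + 1)) ≤ ‖x‖ := by
    refine ⟨min 1 (‖x‖ / (8 * c * (‖u‖ + 1))), by positivity, min_le_left _ _, ?_⟩
    rw [← le_div_iff₀ (by positivity)]
    exact min_le_right _ _
  have hsC : (s : ℂ) ≠ 0 := by exact_mod_cast hs0.ne'
  have hy : (s : ℂ)⁻¹ • x - ((1 - s : ℝ) : ℂ) • T ((s : ℂ)⁻¹ • x) = x := by
    rw [map_smul, hx, smul_smul, ← sub_smul]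
    convert one_smul ℂ x
    push_cast
    field_simp
    ring
  obtain ⟨y', hy'⟩ := exists_sub_smul_apply_eq hT' (r := 1 - s) (by linarith) (by linarith) x
  have main := h.re_inner_resolvent_le hT hT' (by linarith) (by linarith) hy hy'
  have hyu : s * ‖y'‖ ≤ ‖x‖ / (4 * c) + 2 * s * ‖u‖ := by
    -- Subtracting the approximate preimage `u` leaves a small right side, so `s * ‖y'‖` is small.
    have e : (y' - u) - ((1 - s : ℝ) : ℂ) • T' (y' - u) =
        (x - (u - T' u)) - (s : ℂ) • T' u := by
      rw [map_sub]
      rw [← hy']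
      push_cast
      module
    have h2 := norm_le_of_sub_smul_apply hT' (r := 1 - s) (by linarith) (y' - u)
    have h3 : ‖T' u‖ ≤ ‖u‖ := by simpa using T'.le_of_opNorm_le hT' u
    have h4 := norm_sub_le (x - (u - T' u)) ((s : ℂ) • T' u)
    rw [norm_smul, Complex.norm_real, Real.norm_of_nonneg hs0.le] at h4
    rw [e] at h2
    have h5 := norm_sub_norm_le y' u
    nlinarith
  have h6 : (⟪x, x⟫_ℂ).re = ‖x‖ ^ 2 := inner_self_eq_norm_sq (𝕜 := ℂ) x
  have h7 : (⟪y', x⟫_ℂ).re ≤ ‖y'‖ * ‖x‖ :=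
    (Complex.re_le_norm _).trans (norm_inner_le_norm (𝕜 := ℂ) _ _)
  have el : (⟪(2 : ℂ) • (s : ℂ)⁻¹ • x - x, x⟫_ℂ).re = (2 / s - 1) * ‖x‖ ^ 2 := by
    have : (2 : ℂ) • (s : ℂ)⁻¹ • x - x = ((2 / s - 1 : ℝ) : ℂ) • x := by
      push_cast; rw [div_eq_mul_inv]; module
    rw [this, inner_smul_left, Complex.conj_ofReal, Complex.re_ofReal_mul, h6]
  rw [el, inner_sub_left, inner_smul_left, Complex.sub_re, h6, Complex.conj_ofNat, Complex.mul_re,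
    Complex.re_ofNat, Complex.im_ofNat, zero_mul, sub_zero] at main
  have h8 : (2 / s - 1) * ‖x‖ ^ 2 ≤ c * (2 * (‖y'‖ * ‖x‖)) :=
    main.trans (by gcongr; nlinarith [sq_nonneg ‖x‖])
  have h9 : (2 / s - 1) * ‖x‖ ≤ c * (2 * ‖y'‖) :=
    le_of_mul_le_mul_right (by linarith) hxn
  have h10 : (2 - s) * ‖x‖ ≤ 2 * c * (s * ‖y'‖) := by
    have := mul_le_mul_of_nonneg_left h9 hs0.le
    have e : s * ((2 / s - 1) * ‖x‖) = (2 - s) * ‖x‖ := by field_simp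
    linarith
  have h11 : 2 * c * (s * ‖y'‖) ≤ ‖x‖ / 2 + 4 * c * s * ‖u‖ := by
    calc _ ≤ 2 * c * (‖x‖ / (4 * c) + 2 * s * ‖u‖) := by gcongr
      _ = _ := by field_simp; ring
  have h12 : 0 < c * s := by positivity
  nlinarith

/-! ### Rotation to the point `1` -/

omit [CompleteSpace H] in
lemma mem_spectrum_iff_one_mem_smul {T : H →L[ℂ] H} {μ : ℂ} (hμ : μ ≠ 0) :
    μ ∈ spectrum ℂ T ↔ (1 : ℂ) ∈ spectrum ℂ (μ⁻¹ • T) := by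
  have := spectrum.smul_mem_smul_iff (a := T) (s := μ) (r := (Units.mk0 μ hμ)⁻¹)
  rw [← this]
  simp [Units.smul_def, hμ]

omit [CompleteSpace H] in
lemma mem_pointSpectrum_iff {T : H →L[ℂ] H} {μ : ℂ} (hμ : μ ≠ 0) :
    μ ∈ pointSpectrum T ↔ ∃ v, v ≠ 0 ∧ (μ⁻¹ • T) v = v := by
  have key : ∀ v, (μ⁻¹ • T) v = v ↔ T v = μ • v := fun v ↦ inv_smul_eq_iff₀ hμ
  simp_rw [key]
  constructor
  · intro h
    obtain ⟨v, hv⟩ := Module.End.HasEigenvalue.exists_hasEigenvector h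
    exact ⟨v, hv.2, hv.apply_eq_smul⟩
  · rintro ⟨v, hv0, hv⟩
    exact Module.End.hasEigenvalue_of_hasEigenvector
      ⟨Module.End.mem_eigenspace_iff.2 hv, hv0⟩

lemma spectrum_subset_ball_iff {T : H →L[ℂ] H} (hT : ‖T‖ ≤ 1) :
    spectrum ℂ T ⊆ Metric.ball 0 1 ↔ spectrum ℂ T ∩ Metric.sphere 0 1 = ∅ := by
  rw [← Set.disjoint_iff_inter_eq_empty, Set.disjoint_left]
  have hle : ∀ μ ∈ spectrum ℂ T, ‖μ‖ ≤ 1 := by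
    intro μ hμ
    -- Only an inequality, as `H` may be trivial.
    have h1 : ‖(1 : H →L[ℂ] H)‖ ≤ 1 := ContinuousLinearMap.norm_id_le
    refine (spectrum.norm_le_norm_mul_of_mem hμ).trans ?_
    exact mul_le_one₀ hT (norm_nonneg _) h1
  refine forall₂_congr fun μ hμ ↦ ?_
  rw [mem_ball_zero_iff, mem_sphere_zero_iff_norm]
  exact ⟨fun h ↦ h.ne, fun h ↦ lt_of_le_of_ne (hle μ hμ) h⟩

end HarnackSpectrum

theorem mainTheorem8 {H : Type*} [NormedAddCommGroup H] [InnerProductSpace ℂ H]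
    [CompleteSpace H] (T T' : H →L[ℂ] H) (hT : ‖T‖ ≤ 1) (hT' : ‖T'‖ ≤ 1)
    (hdom : HarnackDominated T T') :
    spectrum ℂ T ∩ Metric.sphere (0 : ℂ) 1 = spectrum ℂ T' ∩ Metric.sphere (0 : ℂ) 1 ∧
    pointSpectrum T ∩ Metric.sphere (0 : ℂ) 1 = pointSpectrum T' ∩ Metric.sphere (0 : ℂ) 1 ∧
    (spectrum ℂ T ⊆ Metric.ball (0 : ℂ) 1 ↔ spectrum ℂ T' ⊆ Metric.ball (0 : ℂ) 1) := by
  obtain ⟨c, hc1, h⟩ := hdom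
  have hc : 0 < c := zero_lt_one.trans_le hc1
  have hnorm : ∀ {μ : ℂ}, ‖μ‖ = 1 → ∀ {A : H →L[ℂ] H}, ‖A‖ ≤ 1 → ‖μ⁻¹ • A‖ ≤ 1 := by
    intro μ hμ A hA
    rwa [norm_smul, norm_inv, hμ, inv_one, one_mul]
  have hne : ∀ {μ : ℂ}, ‖μ‖ = 1 → μ ≠ 0 := fun hμ ↦ norm_ne_zero_iff.1 (hμ ▸ one_ne_zero)
  have hrot : ∀ {μ : ℂ}, ‖μ‖ = 1 → HarnackDominatedWith c (μ⁻¹ • T) (μ⁻¹ • T') :=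
    fun hμ ↦ h.smul (by rw [norm_inv, hμ, inv_one])
  have hspec : spectrum ℂ T ∩ Metric.sphere (0 : ℂ) 1 =
      spectrum ℂ T' ∩ Metric.sphere (0 : ℂ) 1 := by
    ext μ
    refine and_congr_left fun hμ ↦ ?_
    rw [mem_sphere_zero_iff_norm] at hμ
    rw [mem_spectrum_iff_one_mem_smul (hne hμ), mem_spectrum_iff_one_mem_smul (hne hμ)]
    exact ⟨(hrot hμ).one_mem_spectrum_right hc (hnorm hμ hT) (hnorm hμ hT'),
      (hrot hμ).one_mem_spectrum_left hc (hnorm hμ hT) (hnorm hμ hT')⟩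
  refine ⟨hspec, ?_, ?_⟩
  · ext μ
    refine and_congr_left fun hμ ↦ ?_
    rw [mem_sphere_zero_iff_norm] at hμ
    rw [mem_pointSpectrum_iff (hne hμ), mem_pointSpectrum_iff (hne hμ)]
    constructor
    · rintro ⟨x, hx0, hx⟩
      exact (hrot hμ).exists_apply_eq_self hc (hnorm hμ hT) (hnorm hμ hT') hx0 hx
    · rintro ⟨x, hx0, hx⟩
      exact ⟨x, hx0, (hrot hμ).apply_eq_self hc.le (hnorm hμ hT) hx⟩
  · rw [spectrum_subset_ball_iff hT, spectrum_subset_ball_iff hT', hspec]
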